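/- Let $\Sigma$ be a finite alphabet. For words $x,y\in\Sigma^*$ the site-directed insertion of $y$ into $x$ is the language $$x \stackrel{\rm sdi}{\leftarrow} y=\{x_1uzvx_2 \mid x=x_1uvx_2,\ y=uzv,\ u\neq\varepsilon,\ v\neq\varepsilon\},$$ and the alphabetic site-directed insertion of $y$ into $x$ is $$x \stackrel{\rm a\text{-}sdi}{\leftarrow} y=\{x_1azbx_2 \mid x=x_1abx_2,\ y=azb,\ a,b\in\Sigma,\ x_1,x_2,z\in\Sigma^*\}.$$ A word $t$ over $\{i,d,\sigma\}$ (a trajectory) guides the deletion of $y\in\Sigma^*$ from $x\in\Sigma^*$ as follows: the symbols of $t$ are read from left to right; $i$ outputs the next letter of $x$; $d$ requires the next letters of $x$ and $y$ to be equal, consumes both and outputs nothing; $\sigma$ requires the next letters of $x$ and $y$ to be equal, consumes both and outputs that letter. If $t$, $x$ and $y$ are used up at the same time, the output is the result $x\leadsto_t y$; otherwise $x\leadsto_t y$ is undefined. For a set $T$ of trajectories, $x\leadsto_T y$ is the set of all defined results $x\leadsto_t y$ with $t\in T$. All operations $\Diamond$ are extended to languages by $L_1\Diamond L_2=\bigcup_{x\in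 L_1,\,y\in L_2}x\Diamond y$; moreover $x\,\Diamond^{\rm rev}\,y=y\,\Diamond\,x$, and $\overline{L}=\Sigma^*\setminus L$. Theorem. Let $L,R\subseteq\Sigma^*$ be regular languages. For each of the equations (a) $X \stackrel{\rm sdi}{\leftarrow} L = R$, (b) $L \stackrel{\rm sdi}{\leftarrow} X = R$, (c) $X \stackrel{\rm a\text{-}sdi}{\leftarrow} L = R$, (d) $L \stackrel{\rm a\text{-}sdi}{\leftarrow} X = R$, it is decidable whether there is a language $X\subseteq\Sigma^*$ that solves it: there is an algorithm which, given the size of $\Sigma$ and nondeterministic finite automata for $L$ and $R$, answers this question. Put $T_1=i^*\sigma^+d^*\sigma^+i^*$, $T_1^a=i^*\sigma d^*\sigma i^*$, $T_2=d^*\sigma^+i^*\sigma^+d^*$ and $T_2^a=d^*\sigma i^*\sigma d^*$. If a solution of the respective equation exists, then every solution $X$ is contained in, respectively, (a) $S_a=\overline{\overline{R}\leadsto_{T_1}L}$, (b) $S_b=\overline{L\,(\leadsto_{T_2})^{\rm rev}\,\overline{R}}$, (c) $S_c=\overline{\overline{R}\leadsto_{T_1^a}L}$, (d) $S_d=\overline{L\,(\leadsto_{T_2^a})^{\rm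 rev}\,\overline{R}}$. -/

import Mathlib

namespace SDI

open scoped Computability

section Operations

variable {α : Type*}

/-- The extension of a binary operation on words (with a set of words as its value)
to languages: `L₁ ⋄ L₂` is the union of all `x ⋄ y` with `x ∈ L₁` and `y ∈ L₂`. -/
def lift (op : List α → List α → Language α) (L₁ L₂ : Language α) : Language α :=
  {w | ∃ x ∈ L₁, ∃ y ∈ L₂, w ∈ op x y}

/-- The reversed operation, `x ⋄ʳᵉᵛ y = y ⋄ x`. -/
def rev (op : List α → List α → Language α) : List α → List α → Language α :=
  fun x y => op y x

/-- Site-directed insertion of the word `y` into the word `x`. -/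
def sdiWord (x y : List α) : Language α :=
  {w | ∃ x₁ u z v x₂ : List α, u ≠ [] ∧ v ≠ [] ∧
    x = x₁ ++ u ++ v ++ x₂ ∧ y = u ++ z ++ v ∧ w = x₁ ++ u ++ z ++ v ++ x₂}

/-- Alphabetic site-directed insertion of the word `y` into the word `x`. -/
def asdiWord (x y : List α) : Language α :=
  {w | ∃ (x₁ z x₂ : List α) (a b : α),
    x = x₁ ++ [a, b] ++ x₂ ∧ y = [a] ++ z ++ [b] ∧ w = x₁ ++ [a] ++ z ++ [b] ++ x₂}

/-- Site-directed insertion of the language `L₂` into the language `L₁`. -/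
def sdi (L₁ L₂ : Language α) : Language α := lift sdiWord L₁ L₂

/-- Alphabetic site-directed insertion of the language `L₂` into the language `L₁`. -/
def asdi (L₁ L₂ : Language α) : Language α := lift asdiWord L₁ L₂

end Operations

/-- The alphabet `{i, d, σ}` of deletion trajectories. -/
inductive DelSymbol : Type
  | i : DelSymbol
  | d : DelSymbol
  | σ : DelSymbol

/-- `DeletesTo t x y w`: deleting the word `y` from the word `x` along the trajectory `t`
is defined and has the result `w`. The symbol `i` outputs the next letter of `x`; the symbol
`d` consumes the next letters of `x` and `y`, which must match, without any output; the
symbol `σ` consumes the next letters of `x` and `y`, which must match, and outputs that letter.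
All of `t`, `x` and `y` have to be used up. -/
inductive DeletesTo {α : Type*} :
    List DelSymbol → List α → List α → List α → Prop
  | nil : DeletesTo [] [] [] []
  | i (a : α) {t : List DelSymbol} {x y w : List α} :
      DeletesTo t x y w → DeletesTo (DelSymbol.i :: t) (a :: x) y (a :: w)
  | d (a : α) {t : List DelSymbol} {x y w : List α} :
      DeletesTo t x y w → DeletesTo (DelSymbol.d :: t) (a :: x) (a :: y) w
  | σ (a : α) {t : List DelSymbol} {x y w : List α} :
      DeletesTo t x y w → DeletesTo (DelSymbol.σ :: t) (a :: x) (a :: y) (a :: w)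

/-- Semantic deletion of the word `y` from the word `x` along the set `T` of trajectories. -/
def delAlong {α : Type*} (T : Language DelSymbol) (x y : List α) : Language α :=
  {w | ∃ t ∈ T, DeletesTo t x y w}

/-- The trajectory set consisting of the one-letter word `c`. -/
def letter (c : DelSymbol) : Language DelSymbol := {[c]}

/-- `c⁺` -/
def plus (c : DelSymbol) : Language DelSymbol := letter c * (letter c)∗

/-- `T₁ = i* σ⁺ d* σ⁺ i*` -/
def T₁ : Language DelSymbol :=
  (letter .i)∗ * plus .σ * (letter .d)∗ * plus .σ * (letter .i)∗

/-- `T₁ᵃ = i* σ d* σ i*` -/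
def T₁a : Language DelSymbol :=
  (letter .i)∗ * letter .σ * (letter .d)∗ * letter .σ * (letter .i)∗

/-- `T₂ = d* σ⁺ i* σ⁺ d*` -/
def T₂ : Language DelSymbol :=
  (letter .d)∗ * plus .σ * (letter .i)∗ * plus .σ * (letter .d)∗

/-- `T₂ᵃ = d* σ i* σ d*` -/
def T₂a : Language DelSymbol :=
  (letter .d)∗ * letter .σ * (letter .i)∗ * letter .σ * (letter .d)∗

/-- A finite description of a nondeterministic finite automaton with the states
`0, …, numStates - 1`: the list of its transitions (source, letter, target), its initial
state and the list of its final states. The letters of a `k`-letter alphabet are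
`0, …, k - 1`; entries that are out of range have no effect. -/
structure NFACode : Type where
  numStates : ℕ
  transitions : List (ℕ × ℕ × ℕ)
  start : ℕ
  accept : List ℕ

namespace NFACode

/-- An NFA description as a tuple. -/
def equivTuple : NFACode ≃ ℕ × List (ℕ × ℕ × ℕ) × ℕ × List ℕ where
  toFun c := (c.numStates, c.transitions, c.start, c.accept)
  invFun p := ⟨p.1, p.2.1, p.2.2.1, p.2.2.2⟩
  left_inv _ := rfl
  right_inv _ := rfl

/-- NFA descriptions are given to algorithms as tuples. -/
instance : Primcodable NFACode := Primcodable.ofEquiv _ equivTuple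

/-- The automaton over the alphabet `{0, …, k - 1}` that `c` describes. -/
def toNFA (c : NFACode) (k : ℕ) : NFA (Fin k) (Fin c.numStates) where
  step p a := {q | (p.val, a.val, q.val) ∈ c.transitions}
  start := {p | p.val = c.start}
  accept := {p | p.val ∈ c.accept}

/-- The language over the alphabet `{0, …, k - 1}` that the automaton accepts. -/
def lang (c : NFACode) (k : ℕ) : Language (Fin k) := (c.toNFA k).accepts

/-- The languages with a description are exactly the regular languages. -/
theorem isRegular_iff {k : ℕ} (L : Language (Fin k)) :
    L.IsRegular ↔ ∃ c : NFACode, c.lang k = L := by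
  classical
  constructor
  · rintro ⟨S, _, M, rfl⟩
    let e := Fintype.equivFin S
    let c : NFACode :=
      { numStates := Fintype.card S
        transitions := (Finset.univ : Finset (S × Fin k)).toList.map
          fun p => ((e p.1).val, p.2.val, (e (M.step p.1 p.2)).val)
        start := (e M.start).val
        accept := ((Finset.univ : Finset S).filter (· ∈ M.accept)).toList.map
          fun s => (e s).val }
    have hstep : ∀ s a, (c.toNFA k).stepSet {e s} a = {e (M.step s a)} := by
      intro s a
      ext q
      simp only [NFA.mem_stepSet, toNFA, c, Set.mem_singleton_iff, exists_eq_left,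
        Set.mem_ofPred_eq, List.mem_map, Finset.mem_toList, Finset.mem_univ, true_and,
        Prod.mk.injEq, Prod.exists, Fin.val_inj, EmbeddingLike.apply_eq_iff_eq]
      constructor
      · rintro ⟨s', a', rfl, rfl, rfl⟩
        rfl
      · rintro rfl
        exact ⟨s, a, rfl, rfl, rfl⟩
    have heval : ∀ w s, (c.toNFA k).evalFrom {e s} w = {e (M.evalFrom s w)} := by
      intro w
      induction w with
      | nil => intro s; rfl
      | cons a w ih =>
        intro s
        rw [NFA.evalFrom_cons, hstep, ih]
        rfl
    have hstart : (c.toNFA k).start = {e M.start} := by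
      ext p
      simp [toNFA, c, Fin.val_inj]
    refine ⟨c, ?_⟩
    ext w
    have h1 : w ∈ c.lang k ↔ e (M.eval w) ∈ (c.toNFA k).accept := by
      rw [lang, NFA.mem_accepts, hstart, heval]
      simp [DFA.eval]
    rw [h1]
    simp [toNFA, c, Fin.val_inj, DFA.mem_accepts]
  · rintro ⟨c, rfl⟩
    exact ⟨_, inferInstance, (c.toNFA k).toDFA, NFA.toDFA_correct⟩

end NFACode

end SDI

/-! Both insertions are instances of `insWord C`, where `C` says which lengths the two matching
parts may have: nonzero, or exactly one.

Containment: if deleting `y ∈ L` from some `w ∉ R` along the trajectories leaves `x`, then `w`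
arises by inserting `y` into `x`. Hence no solution contains `x`. The equations with the unknown on
the right are treated in the same way.

Decidability: `residual op L R` is the largest `X` with `lift op X L ≤ R`, so by monotonicity a
solution exists iff `R ≤ lift op (residual op L R) L`. This inclusion is tested through finite
congruences. `automatonType` is a congruence with finitely many values that determines membership in
`L`, membership in `R`, and `C`. Passing from `f` to `splitType f` records the values at both
factors of every factorization; it preserves finiteness and the congruence property
(`IsCong.splitType`). Two refinements make the residual a union of classes, three more do the same
for the insertion of the two languages. By pigeonhole (`IsCong.exists_short`) every class has a word
of length at most the number of classes, so a failing inclusion fails on a short word. Failure of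
membership in the residual likewise has short witnesses. Solvability thus becomes a statement with
quantifiers over words of computable length (`SmallWitnesses.exists_lift_eq_iff`), which is
primitive recursive in the automata. -/

namespace SDI

open scoped Computability

/-! ### Deletion along trajectories as an inverse of insertion -/

section Deletion

variable {α : Type*}

theorem DeletesTo.append_split {s t : List DelSymbol} {x y w : List α}
    (h : DeletesTo (s ++ t) x y w) :
    ∃ x₁ x₂ y₁ y₂ w₁ w₂, x = x₁ ++ x₂ ∧ y = y₁ ++ y₂ ∧ w = w₁ ++ w₂ ∧
      DeletesTo s x₁ y₁ w₁ ∧ DeletesTo t x₂ y₂ w₂ := by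
  induction s generalizing x y w with
  | nil => exact ⟨[], x, [], y, [], w, rfl, rfl, rfl, .nil, h⟩
  | cons c s ih =>
    cases h with
    | i a h =>
      obtain ⟨x₁, x₂, y₁, y₂, w₁, w₂, rfl, rfl, rfl, h₁, h₂⟩ := ih h
      exact ⟨a :: x₁, x₂, y₁, y₂, a :: w₁, w₂, rfl, rfl, rfl, .i a h₁, h₂⟩
    | d a h =>
      obtain ⟨x₁, x₂, y₁, y₂, w₁, w₂, rfl, rfl, rfl, h₁, h₂⟩ := ih h
      exact ⟨a :: x₁, x₂, a :: y₁, y₂, w₁, w₂, rfl, rfl, rfl, .d a h₁, h₂⟩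
    | σ a h =>
      obtain ⟨x₁, x₂, y₁, y₂, w₁, w₂, rfl, rfl, rfl, h₁, h₂⟩ := ih h
      exact ⟨a :: x₁, x₂, a :: y₁, y₂, a :: w₁, w₂, rfl, rfl, rfl, .σ a h₁, h₂⟩

theorem mem_letter_star {c : DelSymbol} {t : List DelSymbol} :
    t ∈ (letter c)∗ ↔ ∃ n, t = List.replicate n c := by
  constructor
  · rintro ⟨l, rfl, hl⟩
    refine ⟨l.length, ?_⟩
    induction l with
    | nil => rfl
    | cons s l ih =>
      have hs : s = [c] := hl s (by simp)
      have := ih fun r hr => hl r (by simp [hr])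
      rw [List.flatten_cons, this, hs]
      simp [List.replicate_succ]
  · rintro ⟨n, rfl⟩
    refine ⟨List.replicate n [c], ?_, ?_⟩
    · induction n with
      | zero => rfl
      | succ n ih => rw [List.replicate_succ, List.replicate_succ, List.flatten_cons, ← ih]; rfl
    · intro s hs
      exact (List.mem_replicate.1 hs).2

theorem DeletesTo.of_replicate_i {n : ℕ} {x y w : List α}
    (h : DeletesTo (List.replicate n .i) x y w) : y = [] ∧ w = x := by
  induction n generalizing x y w with
  | zero => cases h; exact ⟨rfl, rfl⟩
  | succ n ih =>
    rw [List.replicate_succ] at h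
    cases h with
    | i a h => obtain ⟨rfl, rfl⟩ := ih h; exact ⟨rfl, rfl⟩

theorem DeletesTo.of_replicate_d {n : ℕ} {x y w : List α}
    (h : DeletesTo (List.replicate n .d) x y w) : y = x ∧ w = [] := by
  induction n generalizing x y w with
  | zero => cases h; exact ⟨rfl, rfl⟩
  | succ n ih =>
    rw [List.replicate_succ] at h
    cases h with
    | d a h => obtain ⟨rfl, rfl⟩ := ih h; exact ⟨rfl, rfl⟩

theorem DeletesTo.of_replicate_σ {n : ℕ} {x y w : List α}
    (h : DeletesTo (List.replicate n .σ) x y w) : y = x ∧ w = x ∧ x.length = n := by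
  induction n generalizing x y w with
  | zero => cases h; exact ⟨rfl, rfl, rfl⟩
  | succ n ih =>
    rw [List.replicate_succ] at h
    cases h with
    | σ a h => obtain ⟨rfl, rfl, rfl⟩ := ih h; exact ⟨rfl, rfl, rfl⟩

/-- Insertion of `y` into `x` at a site whose two parts have lengths satisfying `C`. -/
def insWord (C : ℕ → Prop) (x y : List α) : Language α :=
  {w | ∃ x₁ u z v x₂ : List α, C u.length ∧ C v.length ∧
    x = x₁ ++ u ++ v ++ x₂ ∧ y = u ++ z ++ v ∧ w = x₁ ++ u ++ z ++ v ++ x₂}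

theorem sdiWord_eq : (sdiWord : List α → List α → Language α) = insWord (· ≠ 0) := by
  funext x y
  simp [sdiWord, insWord]
  rfl

theorem asdiWord_eq : (asdiWord : List α → List α → Language α) = insWord (· = 1) := by
  funext x y
  ext w
  constructor
  · rintro ⟨x₁, z, x₂, a, b, rfl, rfl, rfl⟩
    exact ⟨x₁, [a], z, [b], x₂, rfl, rfl, by simp, by simp, by simp⟩
  · rintro ⟨x₁, u, z, v, x₂, hu, hv, rfl, rfl, rfl⟩
    obtain ⟨a, rfl⟩ := List.length_eq_one_iff.1 hu
    obtain ⟨b, rfl⟩ := List.length_eq_one_iff.1 hv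
    exact ⟨x₁, z, x₂, a, b, by simp, by simp, by simp⟩

/-- Words of `σ`s whose length satisfies `C`. -/
def sigmas (C : ℕ → Prop) : Language DelSymbol := {t | ∃ n, C n ∧ t = List.replicate n .σ}

theorem plus_eq : plus .σ = sigmas (· ≠ 0) := by
  ext t
  simp only [plus, Language.mem_mul, mem_letter_star, sigmas]
  constructor
  · rintro ⟨a, rfl, b, ⟨n, rfl⟩, rfl⟩
    exact ⟨n + 1, by simp, by simp [List.replicate_succ]⟩
  · rintro ⟨_ | n, hn, rfl⟩
    · exact absurd rfl hn
    · exact ⟨_, rfl, _, ⟨n, rfl⟩, by simp [List.replicate_succ]⟩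

theorem letter_eq : letter .σ = sigmas (· = 1) := by
  ext t
  simp only [letter, sigmas]
  constructor
  · rintro rfl
    exact ⟨1, rfl, rfl⟩
  · rintro ⟨_, rfl, rfl⟩
    rfl

/-- The five blocks of the trajectory cut `w` into `x₁ u z v x₂`: the `i`-blocks give `x₁`, `x₂`,
the `σ`-blocks give `u`, `v`, and the `d`-block gives `z`. Containment of solutions needs only this
direction. -/
theorem mem_insWord_of_delAlong_inner {C : ℕ → Prop} {x y w : List α}
    (h : x ∈ delAlong ((letter .i)∗ * sigmas C * (letter .d)∗ * sigmas C * (letter .i)∗) w y) :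
    w ∈ insWord C x y := by
  obtain ⟨t, ⟨t₁, ⟨t₂, ⟨t₃, ⟨t₄, h₄, s₄, ⟨n₄, c₄, rfl⟩, rfl⟩, s₃, h₃, rfl⟩, s₂, ⟨n₂, c₂, rfl⟩, rfl⟩,
    s₁, h₁, rfl⟩, h⟩ := h
  obtain ⟨m₄, rfl⟩ := mem_letter_star.1 h₄
  obtain ⟨m₃, rfl⟩ := mem_letter_star.1 h₃
  obtain ⟨m₁, rfl⟩ := mem_letter_star.1 h₁
  -- The product of trajectory sets associates to the left, so the blocks are split off from the
  -- right end.
  obtain ⟨_, e₁, _, _, _, _, rfl, rfl, rfl, h, k₁⟩ := h.append_split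
  obtain ⟨_, e₂, _, _, _, _, rfl, rfl, rfl, h, k₂⟩ := h.append_split
  obtain ⟨_, e₃, _, _, _, _, rfl, rfl, rfl, h, k₃⟩ := h.append_split
  obtain ⟨e₅, e₄, _, _, _, _, rfl, rfl, rfl, k₅, k₄⟩ := h.append_split
  obtain ⟨rfl, rfl⟩ := k₁.of_replicate_i
  obtain ⟨rfl, rfl, rfl⟩ := k₂.of_replicate_σ
  obtain ⟨rfl, rfl⟩ := k₃.of_replicate_d
  obtain ⟨rfl, rfl, rfl⟩ := k₄.of_replicate_σ
  obtain ⟨rfl, rfl⟩ := k₅.of_replicate_i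
  exact ⟨_, _, _, _, _, c₄, c₂, by simp, by simp, rfl⟩

/-- Here the host `x` is what is deleted, so `d` and `i` exchange roles: the `d`-blocks give `x₁`,
`x₂` and the `i`-block gives `z`. -/
theorem mem_insWord_of_delAlong_outer {C : ℕ → Prop} {x y w : List α}
    (h : y ∈ delAlong ((letter .d)∗ * sigmas C * (letter .i)∗ * sigmas C * (letter .d)∗) w x) :
    w ∈ insWord C x y := by
  obtain ⟨t, ⟨t₁, ⟨t₂, ⟨t₃, ⟨t₄, h₄, s₄, ⟨n₄, c₄, rfl⟩, rfl⟩, s₃, h₃, rfl⟩, s₂, ⟨n₂, c₂, rfl⟩, rfl⟩,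
    s₁, h₁, rfl⟩, h⟩ := h
  obtain ⟨m₄, rfl⟩ := mem_letter_star.1 h₄
  obtain ⟨m₃, rfl⟩ := mem_letter_star.1 h₃
  obtain ⟨m₁, rfl⟩ := mem_letter_star.1 h₁
  obtain ⟨_, e₁, _, _, _, _, rfl, rfl, rfl, h, k₁⟩ := h.append_split
  obtain ⟨_, e₂, _, _, _, _, rfl, rfl, rfl, h, k₂⟩ := h.append_split
  obtain ⟨_, e₃, _, _, _, _, rfl, rfl, rfl, h, k₃⟩ := h.append_split
  obtain ⟨e₅, e₄, _, _, _, _, rfl, rfl, rfl, k₅, k₄⟩ := h.append_split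
  obtain ⟨rfl, rfl⟩ := k₁.of_replicate_d
  obtain ⟨rfl, rfl, rfl⟩ := k₂.of_replicate_σ
  obtain ⟨rfl, rfl⟩ := k₃.of_replicate_i
  obtain ⟨rfl, rfl, rfl⟩ := k₄.of_replicate_σ
  obtain ⟨rfl, rfl⟩ := k₅.of_replicate_d
  exact ⟨_, _, _, _, _, c₄, c₂, by simp, by simp, rfl⟩

theorem le_compl_lift_delAlong_inner {C : ℕ → Prop} {L R X : Language α}
    (hX : lift (insWord C) X L = R) :
    X ≤ (lift (delAlong ((letter .i)∗ * sigmas C * (letter .d)∗ * sigmas C * (letter .i)∗))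
      Rᶜ L)ᶜ := by
  rintro x hx ⟨w, hw, y, hy, h⟩
  exact hw (hX ▸ ⟨x, hx, y, hy, mem_insWord_of_delAlong_inner h⟩)

theorem le_compl_lift_delAlong_outer {C : ℕ → Prop} {L R X : Language α}
    (hX : lift (insWord C) L X = R) :
    X ≤ (lift (rev (delAlong
      ((letter .d)∗ * sigmas C * (letter .i)∗ * sigmas C * (letter .d)∗))) L Rᶜ)ᶜ := by
  rintro y hy ⟨x, hx, w, hw, h⟩
  exact hw (hX ▸ ⟨x, hx, y, hy, mem_insWord_of_delAlong_outer h⟩)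

end Deletion

/-! ### Congruences on words and their refinement by factorizations -/

section Congruence

variable {α β : Type*}

/-- `f` respects concatenation: the value at `a ++ b` is determined by the values at `a`, `b`. -/
def IsCong (f : List α → β) : Prop :=
  ∀ ⦃a a' b b'⦄, f a = f a' → f b = f b' → f (a ++ b) = f (a' ++ b')

/-- The values of `f` at the two factors of all factorizations of a word. -/
def splitType (f : List α → β) (x : List α) : Set (β × β) :=
  {p | ∃ a b, x = a ++ b ∧ p = (f a, f b)}

variable {f : List α → β}

theorem exists_split_of_splitType_eq {a b x : List α}
    (h : splitType f (a ++ b) = splitType f x) :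
    ∃ a' b', x = a' ++ b' ∧ f a = f a' ∧ f b = f b' := by
  have : (f a, f b) ∈ splitType f x := h ▸ ⟨a, b, rfl, rfl⟩
  obtain ⟨a', b', rfl, h'⟩ := this
  exact ⟨a', b', rfl, (Prod.mk.inj h').1, (Prod.mk.inj h').2⟩

/-- The factorization of `x` with empty second factor is matched by some factorization of `x'`. Its
second factor may be nonempty, so the congruence property is needed to reassemble the values. -/
theorem IsCong.eq_of_splitType_eq (hf : IsCong f) {x x' : List α}
    (h : splitType f x = splitType f x') : f x = f x' := by
  rw [← x.append_nil] at h ⊢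
  obtain ⟨a, b, rfl, ha, hb⟩ := exists_split_of_splitType_eq h
  exact hf ha hb

theorem IsCong.splitType_append_subset (hf : IsCong f) {a a' b b' : List α}
    (ha : splitType f a = splitType f a') (hb : splitType f b = splitType f b') :
    splitType f (a ++ b) ⊆ splitType f (a' ++ b') := by
  rintro _ ⟨p, q, h, rfl⟩
  have ha₀ := hf.eq_of_splitType_eq ha
  have hb₀ := hf.eq_of_splitType_eq hb
  -- The cut of `a ++ b` lies either inside `b` or inside `a`. Only the factor that is cut needs its
  -- `splitType`; for the other one the value of `f` suffices.
  rcases List.append_eq_append_iff.1 h with ⟨r, rfl, rfl⟩ | ⟨r, rfl, rfl⟩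
  · obtain ⟨r', q', rfl, hr, hq⟩ := exists_split_of_splitType_eq hb
    exact ⟨a' ++ r', q', by simp, by rw [hf ha₀ hr, hq]⟩
  · obtain ⟨p', r', rfl, hp, hr⟩ := exists_split_of_splitType_eq ha
    exact ⟨p', r' ++ b', by simp, by rw [hf hr hb₀, hp]⟩

theorem IsCong.splitType (hf : IsCong f) : IsCong (splitType f) := fun _ _ _ _ ha hb =>
  (hf.splitType_append_subset ha hb).antisymm (hf.splitType_append_subset ha.symm hb.symm)

/-- Pumping down: in a word longer than the number of values, two prefixes have the same value, and
the segment between them can be cut out. -/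
theorem IsCong.exists_short [Finite β] (hf : IsCong f) (w : List α) :
    ∃ w', f w' = f w ∧ w'.length ≤ Nat.card β := by
  induction hn : w.length using Nat.strong_induction_on generalizing w with
  | _ n ih =>
    by_cases hle : w.length ≤ Nat.card β
    · exact ⟨w, rfl, hle⟩
    have : ¬ Function.Injective fun i : Fin w.length => f (w.take i) := fun hi => by
      have := Nat.card_le_card_of_injective _ hi
      simp at this
      omega
    simp only [Function.Injective, not_forall] at this
    obtain ⟨i, j, hij, hne⟩ := this
    wlog hlt : i < j generalizing i j
    · exact this j i hij.symm (Ne.symm hne) (lt_of_le_of_ne (not_lt.1 hlt) (Ne.symm hne))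
    have hlt' : (i : ℕ) < j := hlt
    have hcut : f (w.take i ++ w.drop j) = f w := by
      rw [hf hij (rfl : f (w.drop j) = _), List.take_append_drop]
    obtain ⟨w', h₁, h₂⟩ := ih (w.take i ++ w.drop j).length
      (by simp; omega) _ rfl
    exact ⟨w', h₁.trans hcut, h₂⟩

end Congruence

/-! ### The largest candidate solution and bounds for witnesses -/

section LargestSolution

variable {α β : Type*} {op : List α → List α → Language α} {L R : Language α}

/-- The largest language `X` such that `lift op X L ≤ R`. -/
def residual (op : List α → List α → Language α) (L R : Language α) : Language α :=
  {x | ∀ y ∈ L, ∀ w ∈ op x y, w ∈ R}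

theorem not_mem_residual_iff {x : List α} :
    x ∉ residual op L R ↔ ∃ y ∈ L, ∃ w ∈ op x y, w ∉ R := by
  change ¬ (∀ y ∈ L, ∀ w ∈ op x y, w ∈ R) ↔ _
  simp only [not_forall, exists_prop]

/-- Any solution lies inside the residual, and `lift` is monotone; conversely the residual never
produces words outside `R`, so it is itself a solution once it covers `R`. -/
theorem exists_lift_eq_iff : (∃ X, lift op X L = R) ↔ R ≤ lift op (residual op L R) L := by
  constructor
  · rintro ⟨X, rfl⟩ w ⟨x, hx, y, hy, hw⟩
    exact ⟨x, fun y' hy' w' hw' => ⟨x, hx, y', hy', hw'⟩, y, hy, hw⟩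
  · intro h
    refine ⟨_, le_antisymm ?_ h⟩
    rintro w ⟨x, hx, y, hy, hw⟩
    exact hx y hy w hw

theorem lift_rev (X : Language α) : lift (rev op) X L = lift op L X := by
  ext w
  constructor <;> exact fun ⟨x, hx, y, hy, h⟩ => ⟨y, hy, x, hx, h⟩

/-- Membership in `K` depends only on the value of `f`. -/
def Saturated (f : List α → β) (K : Language α) : Prop :=
  ∀ ⦃x x'⦄, f x = f x' → x ∈ K → x' ∈ K

variable {f : List α → β} {C : ℕ → Prop}

/-- An insertion into `x'` uses the four factors `x₁ u v x₂`. Two levels of `splitType` transfer the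
balanced factorization `(x₁ u)(v x₂)` to `x`; inserting the same `z` there gives words with the same
values of `f`. -/
theorem saturated_residual_insWord (hf : IsCong f) (hL : Saturated f L) (hR : Saturated f R)
    (hC : Saturated f {x | C x.length}) :
    Saturated (splitType (splitType f)) (residual (insWord C) L R) := by
  rintro x x' h hx _ hy _ ⟨x₁, u, z, v, x₂, hu, hv, rfl, rfl, rfl⟩
  rw [List.append_assoc] at h
  obtain ⟨p, q, rfl, hp, hq⟩ := exists_split_of_splitType_eq h.symm
  obtain ⟨x₁', u', rfl, h₁, hu'⟩ := exists_split_of_splitType_eq hp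
  obtain ⟨v', x₂', rfl, hv', h₂⟩ := exists_split_of_splitType_eq hq
  exact hR (hf (hf (hf (hf h₁ hu') rfl) hv') h₂).symm
    (hx _ (hL (hf (hf hu' rfl) hv') hy) _
      ⟨x₁', u', z, v', x₂', hC hu' hu, hC hv' hv, by simp, rfl, rfl⟩)

theorem saturated_residual_rev_insWord (hf : IsCong f) (hL : Saturated f L) (hR : Saturated f R)
    (hC : Saturated f {x | C x.length}) :
    Saturated (splitType (splitType f)) (residual (rev (insWord C)) L R) := by
  rintro y y' h hy _ hx _ ⟨x₁, u, z, v, x₂, hu, hv, rfl, rfl, rfl⟩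
  obtain ⟨p, v', rfl, hp, hv₁⟩ := exists_split_of_splitType_eq h.symm
  obtain ⟨u', z', rfl, hu', hz'⟩ := exists_split_of_splitType_eq hp
  have hv' := hf.eq_of_splitType_eq hv₁
  have hw := hf (hf (hf (hf (rfl : f x₁ = f x₁) hu') hz') hv') (rfl : f x₂ = f x₂)
  exact hR hw.symm (hy _ (hL (hf (hf (hf rfl hu') hv') rfl) hx) _
    ⟨x₁, u', z', v', x₂, hC hu' hu, hC hv' hv, rfl, rfl, rfl⟩)

/-- The result of an insertion has five factors, which takes a third level: `((x₁ u)(z v)) x₂`. -/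
theorem saturated_lift_insWord {X Y : Language α} (hf : IsCong f) (hX : Saturated f X)
    (hY : Saturated f Y) (hC : Saturated f {x | C x.length}) :
    Saturated (splitType (splitType (splitType f))) (lift (insWord C) X Y) := by
  rintro _ w' h ⟨_, hx, _, hy, x₁, u, z, v, x₂, hu, hv, rfl, rfl, rfl⟩
  obtain ⟨p, x₂', rfl, hp, h₂⟩ := exists_split_of_splitType_eq h
  rw [List.append_assoc] at hp
  obtain ⟨p, q, rfl, hp, hq⟩ := exists_split_of_splitType_eq hp
  obtain ⟨x₁', u', rfl, h₁, hu'⟩ := exists_split_of_splitType_eq hp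
  obtain ⟨z', v', rfl, hz', hv'⟩ := exists_split_of_splitType_eq hq
  have h₂' := hf.eq_of_splitType_eq (hf.splitType.eq_of_splitType_eq h₂)
  exact ⟨x₁' ++ u' ++ v' ++ x₂', hX (hf (hf (hf h₁ hu') hv') h₂') hx,
    u' ++ z' ++ v', hY (hf (hf hu' hz') hv') hy,
    x₁', u', z', v', x₂', hC hu' hu, hC hv' hv, rfl, rfl, by simp⟩

theorem Saturated.splitType {K : Language α} (hf : IsCong f) (hK : Saturated f K) :
    Saturated (splitType f) K := fun _ _ h hx => hK (hf.eq_of_splitType_eq h) hx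

/-- A bound on the lengths of the words on which the solvability of `lift op X L = R` depends. -/
structure SmallWitnesses (op : List α → List α → Language α) (L R : Language α) (N : ℕ) :
    Prop where
  length_le : ∀ x y w, w ∈ op x y → x.length ≤ w.length ∧ y.length ≤ w.length
  not_mem_residual : ∀ x : List α, x.length ≤ N → x ∉ residual op L R →
    ∃ y ∈ L, ∃ w ∈ op x y, w ∉ R ∧ y.length ≤ 3 * N ∧ w.length ≤ 3 * N
  not_le_lift : ¬ R ≤ lift op (residual op L R) L →
    ∃ w ∈ R, w ∉ lift op (residual op L R) L ∧ w.length ≤ N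

theorem SmallWitnesses.exists_lift_eq_iff {N : ℕ} (h : SmallWitnesses op L R N) :
    (∃ X, lift op X L = R) ↔
      ∀ w : List α, w.length ≤ 3 * N → w ∈ R →
        ∃ x : List α, x.length ≤ 3 * N ∧ ∃ y : List α, y.length ≤ 3 * N ∧ w ∈ op x y ∧ y ∈ L ∧
          ∀ y' : List α, y'.length ≤ 3 * N → ∀ w' : List α, w'.length ≤ 3 * N →
            y' ∈ L → w' ∈ op x y' → w' ∈ R := by
  rw [SDI.exists_lift_eq_iff]
  constructor
  · intro hR w hw hwR
    obtain ⟨x, hx, y, hy, hxy⟩ := hR hwR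
    obtain ⟨h₁, h₂⟩ := h.length_le _ _ _ hxy
    exact ⟨x, h₁.trans hw, y, h₂.trans hw, hxy, hy, fun y' _ w' _ hy' hw' => hx y' hy' w' hw'⟩
  · intro hF
    by_contra hR
    obtain ⟨w, hwR, hw, hN⟩ := h.not_le_lift hR
    obtain ⟨x, -, y, -, hxy, hy, hx⟩ := hF w (by omega) hwR
    have hxS : x ∉ residual op L R := fun hxS => hw ⟨x, hxS, y, hy, hxy⟩
    obtain ⟨y', hy', w', hw', hR', h₁, h₂⟩ :=
      -- The candidate `x` is no longer than `w`, so it obeys the bound `N` and not merely `3 * N`,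
      -- as the witness bound requires.
      h.not_mem_residual x ((h.length_le _ _ _ hxy).1.trans hN) hxS
    exact hR' (hx y' h₁ w' h₂ hy' hw')

theorem exists_short_not_mem_lift [Finite β] {K : Language α} (hf : IsCong f)
    (hR : Saturated f R) (hK : Saturated f K) (h : ¬ R ≤ K) :
    ∃ w ∈ R, w ∉ K ∧ w.length ≤ Nat.card β := by
  obtain ⟨w, hw, hwK⟩ := Set.not_subset.1 h
  obtain ⟨w', hww', hl⟩ := hf.exists_short w
  exact ⟨w', hR hww'.symm hw, fun h => hwK (hK hww' h), hl⟩

/-- The number of types after five refinements of `n` types by `splitType`. -/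
def typeBound (n : ℕ) : ℕ := (fun m => 2 ^ (m * m))^[5] n

theorem natCard_set_prod (β : Type*) [Finite β] :
    Nat.card (Set (β × β)) = 2 ^ (Nat.card β * Nat.card β) := by
  have := Fintype.ofFinite β
  simp [Nat.card_eq_fintype_card]

theorem le_typeBound (n : ℕ) : n ≤ typeBound n := by
  have h : ∀ m, m ≤ 2 ^ (m * m) := fun m =>
    (Nat.le_mul_self m).trans Nat.lt_two_pow_self.le
  exact (h _).trans ((h _).trans ((h _).trans ((h _).trans (h _))))

variable [Finite β] (hf : IsCong f) (hL : Saturated f L) (hR : Saturated f R)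
  (hC : Saturated f {x | C x.length})
include hf hL hR hC

theorem smallWitnesses_insWord :
    SmallWitnesses (insWord C) L R (typeBound (Nat.card β)) where
  length_le := by
    rintro _ _ _ ⟨x₁, u, z, v, x₂, -, -, rfl, rfl, rfl⟩
    simp only [List.length_append]
    omega
  not_mem_residual x hx h := by
    obtain ⟨_, hy, _, ⟨x₁, u, z, v, x₂, hu, hv, rfl, rfl, rfl⟩, hw⟩ := not_mem_residual_iff.1 h
    -- `u` and `v` are factors of the short word `x`; only the inserted middle part `z` can be long.
    obtain ⟨z', hz, hz'⟩ := hf.exists_short z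
    have := hz'.trans (le_typeBound _)
    simp only [List.length_append] at hx
    refine ⟨u ++ z' ++ v, hL (hf (hf rfl hz.symm) rfl) hy, x₁ ++ u ++ z' ++ v ++ x₂,
      ⟨x₁, u, z', v, x₂, hu, hv, rfl, rfl, rfl⟩,
      fun h => hw (hR (hf (hf (hf rfl hz) rfl) rfl) h), ?_, ?_⟩ <;>
    · simp only [List.length_append]
      omega
  not_le_lift h := by
    have hf₂ := hf.splitType.splitType
    have hf₅ := hf₂.splitType.splitType.splitType
    have hR₅ := ((((hR.splitType hf).splitType hf.splitType).splitType hf₂).splitType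
      hf₂.splitType).splitType hf₂.splitType.splitType
    have hS := saturated_residual_insWord hf hL hR hC
    -- The residual is saturated only for the second refinement, so `L` and `C` are lifted to that
    -- level; three further refinements make five.
    have hK := saturated_lift_insWord hf₂ hS ((hL.splitType hf).splitType hf.splitType)
      (Saturated.splitType hf.splitType (hC.splitType hf))
    simpa only [natCard_set_prod, typeBound, Function.iterate_succ, Function.iterate_zero,
      Function.comp_apply, id_eq] using exists_short_not_mem_lift hf₅ hR₅ hK h

theorem smallWitnesses_rev_insWord :
    SmallWitnesses (rev (insWord C)) L R (typeBound (Nat.card β)) where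
  length_le := by
    rintro _ _ _ ⟨x₁, u, z, v, x₂, -, -, rfl, rfl, rfl⟩
    simp only [List.length_append]
    omega
  not_mem_residual y hy h := by
    obtain ⟨_, hx, _, ⟨x₁, u, z, v, x₂, hu, hv, rfl, rfl, rfl⟩, hw⟩ := not_mem_residual_iff.1 h
    -- Now `u z v` is the short word, and only the outer parts can be long. Shortening both gives
    -- length at most `N + 2 * N`, the source of the factor `3`.
    obtain ⟨p, hp, hp'⟩ := hf.exists_short x₁
    obtain ⟨q, hq, hq'⟩ := hf.exists_short x₂
    have := hp'.trans (le_typeBound _)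
    have := hq'.trans (le_typeBound _)
    simp only [List.length_append] at hy
    refine ⟨p ++ u ++ v ++ q, hL (hf (hf (hf hp.symm rfl) rfl) hq.symm) hx,
      p ++ u ++ z ++ v ++ q, ⟨p, u, z, v, q, hu, hv, rfl, rfl, rfl⟩,
      fun h => hw (hR (hf (hf (hf (hf hp rfl) rfl) rfl) hq) h), ?_, ?_⟩ <;>
    · simp only [List.length_append]
      omega
  not_le_lift h := by
    have hf₂ := hf.splitType.splitType
    have hf₅ := hf₂.splitType.splitType.splitType
    have hR₅ := ((((hR.splitType hf).splitType hf.splitType).splitType hf₂).splitType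
      hf₂.splitType).splitType hf₂.splitType.splitType
    have hS := saturated_residual_rev_insWord hf hL hR hC
    have hK := saturated_lift_insWord hf₂ ((hL.splitType hf).splitType hf.splitType) hS
      (Saturated.splitType hf.splitType (hC.splitType hf))
    rw [← lift_rev] at hK
    simpa only [natCard_set_prod, typeBound, Function.iterate_succ, Function.iterate_zero,
      Function.comp_apply, id_eq] using exists_short_not_mem_lift hf₅ hR₅ hK h

end LargestSolution

/-! ### The finite congruence given by two automata -/

section AutomatonType

variable {α σ τ : Type*}

/-- The transition maps of a word in two automata, and its length up to `2`. -/
def automatonType (M : NFA α σ) (N : NFA α τ) (x : List α) :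
    (Set σ → Set σ) × (Set τ → Set τ) × Fin 3 :=
  (fun S => M.evalFrom S x, fun S => N.evalFrom S x, ⟨min x.length 2, by omega⟩)

variable {M : NFA α σ} {N : NFA α τ}

theorem automatonType_eq_iff {x x' : List α} :
    automatonType M N x = automatonType M N x' ↔
      (∀ S, M.evalFrom S x = M.evalFrom S x') ∧ (∀ S, N.evalFrom S x = N.evalFrom S x') ∧
        min x.length 2 = min x'.length 2 := by
  simp [automatonType, funext_iff]

theorem isCong_automatonType : IsCong (automatonType M N) := by
  intro a a' b b' ha hb
  rw [automatonType_eq_iff] at *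
  refine ⟨fun S => ?_, fun S => ?_, ?_⟩
  · rw [NFA.evalFrom_append, NFA.evalFrom_append, ha.1, hb.1]
  · rw [NFA.evalFrom_append, NFA.evalFrom_append, ha.2.1, hb.2.1]
  · simp only [List.length_append]
    omega

theorem saturated_accepts_left : Saturated (automatonType M N) M.accepts := by
  intro x x' h hx
  rw [NFA.mem_accepts] at *
  rwa [← (automatonType_eq_iff.1 h).1]

theorem saturated_accepts_right : Saturated (automatonType M N) N.accepts := by
  intro x x' h hx
  rw [NFA.mem_accepts] at *
  rwa [← (automatonType_eq_iff.1 h).2.1]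

theorem saturated_length {C : ℕ → Prop} (hC : ∀ a b, min a 2 = min b 2 → C a → C b) :
    Saturated (automatonType M N) {x | C x.length} :=
  fun _ _ h => hC _ _ (automatonType_eq_iff.1 h).2.2

end AutomatonType

/-! ### Primitive recursive enumeration of words and simulation of automata -/

section PrimitiveRecursion

open Primrec

variable {α β : Type*} [Primcodable α] [Primcodable β]

theorem primrecPred_exists_mem {f : α → List β} {P : α → β → Prop} (hf : Primrec f)
    (hP : PrimrecRel P) : PrimrecPred fun a => ∃ b ∈ f a, P a b :=
  (PrimrecRel.exists_mem_list (R := fun b a => P a b) (hP.comp snd fst)).comp hf .id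

theorem primrecPred_forall_mem {f : α → List β} {P : α → β → Prop} (hf : Primrec f)
    (hP : PrimrecRel P) : PrimrecPred fun a => ∀ b ∈ f a, P a b :=
  (PrimrecRel.forall_mem_list (R := fun b a => P a b) (hP.comp snd fst)).comp hf .id

theorem primrecPred_imp {p q : α → Prop} (hp : PrimrecPred p) (hq : PrimrecPred q) :
    PrimrecPred fun a => p a → q a :=
  (hp.not.or hq).of_eq fun _ => imp_iff_not_or.symm

theorem primrecRel_mem : PrimrecRel fun (a : α) (l : List α) => a ∈ l :=
  (primrecPred_exists_mem (f := fun p : α × List α => p.2) (P := fun p b => b = p.1) snd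
    (Primrec.eq.comp snd (fst.comp fst))).of_eq fun p => by simp

theorem primrec_pow : Primrec₂ ((· ^ ·) : ℕ → ℕ → ℕ) :=
  (nat_rec (f := fun _ : ℕ => 1) (g := fun m p => p.2 * m) (const 1)
    (nat_mul.comp (snd.comp snd) fst)).of_eq fun m n => by
      induction n with
      | zero => rfl
      | succ n ih => exact (congrArg (· * m) ih).trans (pow_succ m n).symm

/-- The words of length at most `n` over the alphabet `{0, …, k - 1}`. -/
def words (k n : ℕ) : List (List ℕ) :=
  n.rec [[]] fun _ l => [] :: l.flatMap fun w => (List.range k).map fun a => a :: w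

theorem primrec_words : Primrec₂ words := by
  refine nat_rec (f := fun _ : ℕ => [[]])
    (g := fun k p => [] :: p.2.flatMap fun w => (List.range k).map fun a => a :: w) (const _) ?_
  refine list_cons.comp (const _) (list_flatMap (snd.comp snd) ?_)
  exact list_map (list_range.comp (fst.comp fst)) (list_cons.comp snd (snd.comp fst))

theorem mem_words {k n : ℕ} {v : List ℕ} :
    v ∈ words k n ↔ v.length ≤ n ∧ ∀ a ∈ v, a < k := by
  induction n generalizing v with
  | zero => cases v <;> simp [words]
  | succ n ih =>
    have : words k (n + 1) =
      [] :: (words k n).flatMap fun w => (List.range k).map fun a => a :: w := rfl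
    cases v with
    | nil => simp [this]
    | cons a v =>
      simp [this, ih]
      tauto

theorem forall_mem_words {k n : ℕ} {P : List ℕ → Prop} :
    (∀ v ∈ words k n, P v) ↔ ∀ w : List (Fin k), w.length ≤ n → P (w.map Fin.val) := by
  constructor
  · intro h w hw
    exact h _ (mem_words.2 ⟨by simpa using hw, by simp⟩)
  · intro h v hv
    obtain ⟨h₁, h₂⟩ := mem_words.1 hv
    lift v to List (Fin k) using h₂
    exact h v (by simpa using h₁)

theorem exists_mem_words {k n : ℕ} {P : List ℕ → Prop} :
    (∃ v ∈ words k n, P v) ↔ ∃ w : List (Fin k), w.length ≤ n ∧ P (w.map Fin.val) := by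
  have := forall_mem_words (k := k) (n := n) (P := fun v => ¬ P v)
  simpa using not_congr this

namespace NFACode

theorem primrec_equivTuple : Primrec equivTuple := of_equiv

theorem primrec_numStates : Primrec numStates := fst.comp primrec_equivTuple

theorem primrec_transitions : Primrec transitions := (fst.comp snd).comp primrec_equivTuple

theorem primrec_start : Primrec start := (fst.comp (snd.comp snd)).comp primrec_equivTuple

theorem primrec_accept : Primrec accept := (snd.comp (snd.comp snd)).comp primrec_equivTuple

/-- One step of the simulation of the automaton on lists of states. -/
def simStep (c : NFACode) (S : List ℕ) (a : ℕ) : List ℕ :=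
  c.transitions.flatMap fun t =>
    if t.1 ∈ S ∧ t.2.1 = a ∧ t.2.2 < c.numStates then [t.2.2] else []

/-- The list of the states that the automaton reaches from its initial state. -/
def sim (c : NFACode) (w : List ℕ) : List ℕ :=
  w.foldl c.simStep (if c.start < c.numStates then [c.start] else [])

/-- Acceptance of a list of numbers. -/
def Accepts (c : NFACode) (w : List ℕ) : Prop := ∃ q ∈ c.sim w, q ∈ c.accept

theorem primrec_simStep : Primrec fun p : NFACode × List ℕ × ℕ => p.1.simStep p.2.1 p.2.2 := by
  refine list_flatMap (primrec_transitions.comp fst) (Primrec.ite ?_ ?_ (const _))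
  · refine PrimrecPred.and ?_ (.and ?_ ?_)
    · exact primrecRel_mem.comp (fst.comp snd) (fst.comp (snd.comp fst))
    · exact Primrec.eq.comp (fst.comp (snd.comp snd)) (snd.comp (snd.comp fst))
    · exact nat_lt.comp (snd.comp (snd.comp snd)) (primrec_numStates.comp (fst.comp fst))
  · exact list_cons.comp (snd.comp (snd.comp snd)) (const _)

theorem primrec_sim : Primrec₂ sim := by
  have h : Primrec fun p : NFACode × List ℕ =>
      if p.1.start < p.1.numStates then [p.1.start] else [] :=
    Primrec.ite (nat_lt.comp (primrec_start.comp fst) (primrec_numStates.comp fst))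
      (list_cons.comp (primrec_start.comp fst) (const _)) (const _)
  have hs : Primrec₂ fun (p : NFACode × List ℕ) (q : List ℕ × ℕ) => p.1.simStep q.1 q.2 :=
    primrec_simStep.comp ((fst.comp fst).pair snd)
  exact (list_foldl snd h hs).to₂

theorem primrecRel_accepts : PrimrecRel Accepts :=
  primrecPred_exists_mem (P := fun (p : NFACode × List ℕ) q => q ∈ p.1.accept) primrec_sim
    (primrecRel_mem.comp snd (primrec_accept.comp (fst.comp fst)))

/-- The simulation invariant, for arbitrary sets of current states so that induction on the word
applies. The range test in `simStep` discards targets that are not states of the automaton. -/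
theorem mem_foldl_simStep {k : ℕ} (c : NFACode) (w : List (Fin k)) (S : List ℕ)
    (T : Set (Fin c.numStates)) (h : ∀ n, n ∈ S ↔ ∃ q ∈ T, q.val = n) (n : ℕ) :
    n ∈ (w.map Fin.val).foldl c.simStep S ↔ ∃ q ∈ (c.toNFA k).evalFrom T w, q.val = n := by
  induction w generalizing S T with
  | nil => exact h n
  | cons a w ih =>
    rw [NFA.evalFrom_cons]
    refine ih _ _ fun m => ?_
    simp only [simStep, List.mem_flatMap, NFA.mem_stepSet, toNFA, h]
    constructor
    · rintro ⟨⟨s, b, t⟩, hmem, hm⟩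
      split_ifs at hm with hc
      · obtain ⟨hs, rfl, ht⟩ := hc
        obtain ⟨q, hq, rfl⟩ := (h s).1 hs
        obtain rfl := List.mem_singleton.1 hm
        exact ⟨⟨m, ht⟩, ⟨q, hq, hmem⟩, rfl⟩
      · simp at hm
    · rintro ⟨q', ⟨q, hq, hmem⟩, rfl⟩
      refine ⟨_, hmem, ?_⟩
      rw [if_pos ⟨(h q).2 ⟨q, hq, rfl⟩, rfl, q'.isLt⟩]
      simp

theorem accepts_iff {k : ℕ} (c : NFACode) (w : List (Fin k)) :
    c.Accepts (w.map Fin.val) ↔ w ∈ c.lang k := by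
  have h := mem_foldl_simStep c w (if c.start < c.numStates then [c.start] else [])
    (c.toNFA k).start fun n => by
      simp only [toNFA]
      split_ifs with hs
      · simp only [List.mem_singleton]
        exact ⟨fun h => ⟨⟨c.start, hs⟩, rfl, h.symm⟩, fun ⟨q, hq, h⟩ => h.symm.trans hq⟩
      · simp only [List.not_mem_nil, false_iff]
        rintro ⟨q, hq, -⟩
        exact hs (hq ▸ q.isLt)
  simp only [Accepts, sim, h, lang, NFA.mem_accepts]
  constructor
  · rintro ⟨_, ⟨q, hq, rfl⟩, ha⟩
    exact ⟨q, ha, hq⟩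
  · rintro ⟨q, ha, hq⟩
    exact ⟨_, ⟨q, hq, rfl⟩, ha⟩

end NFACode

end PrimitiveRecursion

/-! ### The bounded search as a primitive recursive predicate -/

section Decision

open Primrec

/-- A pair of automata over a common alphabet whose size is the first component. -/
abbrev Instance : Type := ℕ × NFACode × NFACode

/-- `insWord C` for lists of numbers, with all parts taken from the list `W`. -/
def InsFrom (C : ℕ → Prop) (W : List (List ℕ)) (x y w : List ℕ) : Prop :=
  ∃ x₁ ∈ W, ∃ u ∈ W, ∃ z ∈ W, ∃ v ∈ W, ∃ x₂ ∈ W, C u.length ∧ C v.length ∧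
    x = x₁ ++ u ++ v ++ x₂ ∧ y = u ++ z ++ v ∧ w = x₁ ++ u ++ z ++ v ++ x₂

theorem primrecPred_insFrom {C : ℕ → Prop} (hC : PrimrecPred C) :
    PrimrecPred fun p : List (List ℕ) × List ℕ × List ℕ × List ℕ =>
      InsFrom C p.1 p.2.1 p.2.2.1 p.2.2.2 := by
  refine primrecPred_exists_mem fst ?_
  refine primrecPred_exists_mem (fst.comp fst) ?_
  refine primrecPred_exists_mem (fst.comp (fst.comp fst)) ?_
  refine primrecPred_exists_mem (fst.comp (fst.comp (fst.comp fst))) ?_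
  refine primrecPred_exists_mem (fst.comp (fst.comp (fst.comp (fst.comp fst)))) ?_
  have p₂ := @fst (((((List (List ℕ) × List ℕ × List ℕ × List ℕ) × List ℕ) × List ℕ) × List ℕ) ×
    List ℕ) (List ℕ) _ _
  have p₃ := fst.comp p₂
  have p₄ := fst.comp p₃
  have p₅ := fst.comp p₄
  have q := snd.comp (fst.comp p₅)
  have u := snd.comp p₄
  have z := snd.comp p₃
  have v := snd.comp p₂
  have h₁ := list_append.comp (snd.comp p₅) u
  have h₂ := list_append.comp u z
  refine (hC.comp (list_length.comp u)).and <| (hC.comp (list_length.comp v)).and <|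
    PrimrecPred.and ?_ <| PrimrecPred.and ?_ ?_
  · exact Primrec.eq.comp (fst.comp q) (list_append.comp (list_append.comp h₁ v) snd)
  · exact Primrec.eq.comp (fst.comp (snd.comp q)) (list_append.comp h₂ v)
  · exact Primrec.eq.comp (snd.comp (snd.comp q))
      (list_append.comp (list_append.comp (list_append.comp h₁ z) v) snd)

theorem insFrom_words_iff {C : ℕ → Prop} {k n : ℕ} {x y w : List (Fin k)} (hw : w.length ≤ n) :
    InsFrom C (words k n) (x.map Fin.val) (y.map Fin.val) (w.map Fin.val) ↔
      w ∈ insWord C x y := by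
  have inj : Function.Injective (List.map (Fin.val : Fin k → ℕ)) :=
    List.map_injective_iff.2 Fin.val_injective
  simp only [InsFrom, exists_mem_words, ← List.map_append, inj.eq_iff, List.length_map]
  constructor
  · rintro ⟨x₁, -, u, -, z, -, v, -, x₂, -, h⟩
    exact ⟨x₁, u, z, v, x₂, h⟩
  · rintro ⟨x₁, u, z, v, x₂, h⟩
    have h' := hw
    simp only [h.2.2.2.2, List.length_append] at h'
    -- All five parts are factors of `w`, so the bound on `w` puts them in the list.
    exact ⟨x₁, by omega, u, by omega, z, by omega, v, by omega, x₂, by omega, h⟩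

/-- A bound for the lengths of the words that are relevant for two automata. -/
def lengthBound (p : Instance) : ℕ :=
  typeBound ((2 ^ p.2.1.numStates) ^ (2 ^ p.2.1.numStates) *
    ((2 ^ p.2.2.numStates) ^ (2 ^ p.2.2.numStates) * 3))

theorem primrec_typeBound : Primrec typeBound := by
  have h : Primrec fun m : ℕ => 2 ^ (m * m) := primrec_pow.comp (const 2) (nat_mul.comp .id .id)
  exact h.comp (h.comp (h.comp (h.comp h)))

theorem primrec_lengthBound : Primrec lengthBound := by
  have h : Primrec fun n : ℕ => (2 ^ n) ^ (2 ^ n) :=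
    primrec_pow.comp (primrec_pow.comp (const 2) .id) (primrec_pow.comp (const 2) .id)
  exact primrec_typeBound.comp <| nat_mul.comp
    (h.comp (NFACode.primrec_numStates.comp (fst.comp snd)))
    (nat_mul.comp (h.comp (NFACode.primrec_numStates.comp (snd.comp snd))) (const 3))

theorem natCard_automatonType {m n : ℕ} :
    Nat.card ((Set (Fin m) → Set (Fin m)) × (Set (Fin n) → Set (Fin n)) × Fin 3) =
      (2 ^ m) ^ (2 ^ m) * ((2 ^ n) ^ (2 ^ n) * 3) := by
  simp [Nat.card_eq_fintype_card]

/-- The words that are relevant for two automata. -/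
def relevantWords (p : Instance) : List (List ℕ) := words p.1 (3 * lengthBound p)

theorem primrec_relevantWords : Primrec relevantWords :=
  primrec_words.comp fst (nat_mul.comp (const 3) primrec_lengthBound)

/-- Solvability of `X ⋄ L = R` with all words taken from the list `W p`, where `Q (W p) x y w`
stands for `w ∈ x ⋄ y`. -/
def SolvableIn (W : Instance → List (List ℕ))
    (Q : List (List ℕ) → List ℕ → List ℕ → List ℕ → Prop) (p : Instance) : Prop :=
  ∀ w ∈ W p, p.2.2.Accepts w →
    ∃ x ∈ W p, ∃ y ∈ W p, Q (W p) x y w ∧ p.2.1.Accepts y ∧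
      ∀ y' ∈ W p, ∀ w' ∈ W p, p.2.1.Accepts y' → Q (W p) x y' w' → p.2.2.Accepts w'

theorem primrecPred_solvableIn {W : Instance → List (List ℕ)} (hW : Primrec W)
    {Q : List (List ℕ) → List ℕ → List ℕ → List ℕ → Prop}
    (hQ : PrimrecPred fun p : List (List ℕ) × List ℕ × List ℕ × List ℕ =>
      Q p.1 p.2.1 p.2.2.1 p.2.2.2) : PrimrecPred (SolvableIn W Q) := by
  have hQ' : ∀ {γ : Type} [Primcodable γ] {g : γ → Instance} {x y w : γ → List ℕ}, Primrec g →
      Primrec x → Primrec y → Primrec w → PrimrecPred fun c => Q (W (g c)) (x c) (y c) (w c) :=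
    fun hg hx hy hw => hQ.comp ((hW.comp hg).pair (hx.pair (hy.pair hw)))
  have hL : ∀ {γ : Type} [Primcodable γ] {g : γ → Instance} {y : γ → List ℕ}, Primrec g →
      Primrec y → PrimrecPred fun c => (g c).2.1.Accepts (y c) :=
    fun hg hy => NFACode.primrecRel_accepts.comp (fst.comp (snd.comp hg)) hy
  have hR : ∀ {γ : Type} [Primcodable γ] {g : γ → Instance} {w : γ → List ℕ}, Primrec g →
      Primrec w → PrimrecPred fun c => (g c).2.2.Accepts (w c) :=
    fun hg hw => NFACode.primrecRel_accepts.comp (snd.comp (snd.comp hg)) hw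
  refine primrecPred_forall_mem hW ?_
  refine primrecPred_imp (hR fst snd) ?_
  refine primrecPred_exists_mem (hW.comp fst) ?_
  refine primrecPred_exists_mem (hW.comp (fst.comp fst)) ?_
  refine PrimrecPred.and ?_ (PrimrecPred.and ?_ ?_)
  · exact hQ' (fst.comp (fst.comp fst)) (snd.comp fst) snd (snd.comp (fst.comp fst))
  · exact hL (fst.comp (fst.comp fst)) snd
  refine primrecPred_forall_mem (hW.comp (fst.comp (fst.comp fst))) ?_
  refine primrecPred_forall_mem (hW.comp (fst.comp (fst.comp (fst.comp fst)))) ?_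
  have r := @fst (((Instance × List ℕ) × List ℕ) × List ℕ) (List ℕ) _ _
  refine primrecPred_imp ?_ (primrecPred_imp ?_ ?_)
  · exact hL (fst.comp (fst.comp (fst.comp (r.comp fst)))) (snd.comp fst)
  · exact hQ' (fst.comp (fst.comp (fst.comp (r.comp fst)))) (snd.comp (fst.comp (r.comp fst)))
      (snd.comp fst) snd
  · exact hR (fst.comp (fst.comp (fst.comp (r.comp fst)))) snd

theorem solvableIn_iff {Q : List (List ℕ) → List ℕ → List ℕ → List ℕ → Prop} {p : Instance}
    {op : List (Fin p.1) → List (Fin p.1) → Language (Fin p.1)}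
    (h : SmallWitnesses op (p.2.1.lang p.1) (p.2.2.lang p.1) (lengthBound p))
    (hQ : ∀ x y w, w.length ≤ 3 * lengthBound p →
      (Q (relevantWords p) (x.map Fin.val) (y.map Fin.val) (w.map Fin.val) ↔ w ∈ op x y)) :
    SolvableIn relevantWords Q p ↔ ∃ X, lift op X (p.2.1.lang p.1) = p.2.2.lang p.1 := by
  rw [h.exists_lift_eq_iff]
  simp only [SolvableIn]
  conv_lhs => simp only [relevantWords]
  simp only [forall_mem_words, exists_mem_words, NFACode.accepts_iff]
  refine forall_congr' fun w => forall_congr' fun hw => forall_congr' fun _ =>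
    exists_congr fun x => and_congr_right fun _ => exists_congr fun y => and_congr_right fun _ =>
    and_congr (hQ x y w hw) <| and_congr_right fun _ => forall_congr' fun y' =>
    forall_congr' fun _ => forall_congr' fun w' => forall_congr' fun hw' =>
    forall_congr' fun _ => imp_congr (hQ x y' w' hw') Iff.rfl

variable {C : ℕ → Prop} (hC : ∀ a b, min a 2 = min b 2 → C a → C b) (hp : PrimrecPred C)
include hC hp

theorem computablePred_exists_lift_insWord_left : ComputablePred fun p : Instance =>
    ∃ X : Language (Fin p.1), lift (insWord C) X (p.2.1.lang p.1) = p.2.2.lang p.1 :=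
  (primrecPred_solvableIn primrec_relevantWords (primrecPred_insFrom hp)).computablePred.of_eq fun p =>
    solvableIn_iff (by
      have := smallWitnesses_insWord (isCong_automatonType (M := p.2.1.toNFA p.1)
        (N := p.2.2.toNFA p.1)) saturated_accepts_left saturated_accepts_right
        (saturated_length hC)
      rwa [natCard_automatonType] at this)
      fun _ _ _ hw => insFrom_words_iff hw

theorem computablePred_exists_lift_insWord_right : ComputablePred fun p : Instance =>
    ∃ X : Language (Fin p.1), lift (insWord C) (p.2.1.lang p.1) X = p.2.2.lang p.1 := by
  -- The composed map exchanges the host and the inserted word, matching `rev (insWord C)`.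
  have hQ := (primrecPred_insFrom hp).comp (fst.pair ((fst.comp (snd.comp snd)).pair
    ((fst.comp snd).pair (snd.comp (snd.comp snd)))))
  refine (primrecPred_solvableIn primrec_relevantWords (Q := fun W x y w => InsFrom C W y x w)
    hQ).computablePred.of_eq fun p => ?_
  simp only [← lift_rev (op := insWord C)]
  refine solvableIn_iff ?_ fun _ _ _ hw => insFrom_words_iff hw
  have := smallWitnesses_rev_insWord (isCong_automatonType (M := p.2.1.toNFA p.1)
    (N := p.2.2.toNFA p.1)) saturated_accepts_left saturated_accepts_right (saturated_length hC)
  rwa [natCard_automatonType] at this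

end Decision

end SDI

theorem theorem2 :
    -- decidability, uniformly in the size of the alphabet and in NFAs for `L` and `R`
    (ComputablePred fun p : ℕ × SDI.NFACode × SDI.NFACode =>
        ∃ X : Language (Fin p.1), SDI.sdi X (p.2.1.lang p.1) = p.2.2.lang p.1) ∧
    (ComputablePred fun p : ℕ × SDI.NFACode × SDI.NFACode =>
        ∃ X : Language (Fin p.1), SDI.sdi (p.2.1.lang p.1) X = p.2.2.lang p.1) ∧
    (ComputablePred fun p : ℕ × SDI.NFACode × SDI.NFACode =>
        ∃ X : Language (Fin p.1), SDI.asdi X (p.2.1.lang p.1) = p.2.2.lang p.1) ∧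
    (ComputablePred fun p : ℕ × SDI.NFACode × SDI.NFACode =>
        ∃ X : Language (Fin p.1), SDI.asdi (p.2.1.lang p.1) X = p.2.2.lang p.1) ∧
    -- the supersets of all solutions
    (∀ (α : Type*) [Finite α] (L R : Language α), L.IsRegular → R.IsRegular →
      ((∃ X, SDI.sdi X L = R) →
        ∀ X, SDI.sdi X L = R → X ≤ (SDI.lift (SDI.delAlong SDI.T₁) Rᶜ L)ᶜ) ∧
      ((∃ X, SDI.sdi L X = R) →
        ∀ X, SDI.sdi L X = R → X ≤ (SDI.lift (SDI.rev (SDI.delAlong SDI.T₂)) L Rᶜ)ᶜ) ∧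
      ((∃ X, SDI.asdi X L = R) →
        ∀ X, SDI.asdi X L = R → X ≤ (SDI.lift (SDI.delAlong SDI.T₁a) Rᶜ L)ᶜ) ∧
      ((∃ X, SDI.asdi L X = R) →
        ∀ X, SDI.asdi L X = R →
          X ≤ (SDI.lift (SDI.rev (SDI.delAlong SDI.T₂a)) L Rᶜ)ᶜ)) := by

  -- Both length conditions depend only on whether a length is `0`, `1` or at least `2`, which
  -- `automatonType` records.
  have hs : ∀ a b : ℕ, min a 2 = min b 2 → a ≠ 0 → b ≠ 0 := by omega
  have ha : ∀ a b : ℕ, min a 2 = min b 2 → a = 1 → b = 1 := by omega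
  have ps : PrimrecPred fun n : ℕ => n ≠ 0 := (Primrec.eq.comp .id (.const 0)).not
  have pa : PrimrecPred fun n : ℕ => n = 1 := Primrec.eq.comp .id (.const 1)
  simp only [SDI.sdi, SDI.asdi, SDI.sdiWord_eq, SDI.asdiWord_eq]
  refine ⟨SDI.computablePred_exists_lift_insWord_left hs ps,
    SDI.computablePred_exists_lift_insWord_right hs ps,
    SDI.computablePred_exists_lift_insWord_left ha pa,
    SDI.computablePred_exists_lift_insWord_right ha pa, fun α _ L R _ _ => ?_⟩
  rw [SDI.T₁, SDI.T₂, SDI.T₁a, SDI.T₂a, SDI.plus_eq, SDI.letter_eq]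
  exact ⟨fun _ _ => SDI.le_compl_lift_delAlong_inner, fun _ _ => SDI.le_compl_lift_delAlong_outer,
    fun _ _ => SDI.le_compl_lift_delAlong_inner, fun _ _ => SDI.le_compl_lift_delAlong_outer⟩
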